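/- Let $\mathcal M$ be a W$^*$-algebra with a normal, faithful, tracial state $\tau$, represented by left multiplication on the Hilbert space $L^2(\mathcal M,\tau)$ of the Gelfand--Naimark--Segal construction. Let $\mathcal N\subseteq\mathcal M$ be a unital W$^*$-subalgebra, let $\mathcal E:\mathcal M\to\mathcal N$ be the $\tau$-preserving conditional expectation onto $\mathcal N$, and regard $L^2(\mathcal N,\tau|_{\mathcal N})$ as the closed subspace of $L^2(\mathcal M,\tau)$ given by the closure of $\mathcal N$. For $t\in[0,1]$ and $a\in\mathcal M$ let \[ s_t(a)=\inf\{\|a(1-q)\| : q\in\mathcal M \text{ a (self-adjoint) projection},\ \tau(q)\le t\} \] be the $t$-th singular number of $a$, and for a positive operator $x$ let $1_{[0,\mu]}(x)$ denote its spectral projection for the set $[0,\mu]$. Let $b\in\mathcal M$. Suppose that there are integers $p\ge 0$ and $1\le n(1)<n(2)<\cdots$, a number $\theta\in(0,1)$ and numbers $\mu_k\ge 0$ $(k\in\mathbb N)$ such that $s_\theta(b^{n(k)})\ne 0$ for all $k$ and \[ \lim_{k\to\infty}\frac{\mu_k}{s_\theta(b^{n(k)})^2}=0 , \] and that there are vectors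 $\zeta_k\in L^2(\mathcal N,\tau|_{\mathcal N})$ such that \[ \zeta_k=1_{[0,\mu_k]}\bigl(\mathcal E(b^{n(k)+p}(b^*)^{n(k)+p})\bigr)\,\zeta_k\qquad(k\in\mathbb N) \] and such that $\zeta_k$ converges in norm to a nonzero vector $\zeta\in L^2(\mathcal N,\tau|_{\mathcal N})$ as $k\to\infty$. Then $b$ has a nontrivial hyperinvariant subspace: there is a closed subspace $V$ of $L^2(\mathcal M,\tau)$ with $V\ne\{0\}$ and $V\ne L^2(\mathcal M,\tau)$ such that $SV\subseteq V$ for every bounded operator $S$ on $L^2(\mathcal M,\tau)$ that commutes with $b$. -/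

import Mathlib

open scoped ComplexOrder InnerProductSpace
open Filter Topology

universe u

noncomputable section

namespace TracialVN

section Trace

variable {M : Type u} [CStarAlgebra M] [PartialOrder M] [StarOrderedRing M]

/-- A positive linear functional `τ` on a W⋆-algebra is *normal* if it preserves suprema of
bounded increasing nets of positive elements (indexed here by the directed set of their values). -/
def IsNormal (τ : M →ₚ[ℂ] ℂ) : Prop :=
  ∀ (D : Set M) (x : M), D.Nonempty → DirectedOn (· ≤ ·) D → (∀ d ∈ D, 0 ≤ d) → IsLUB D x →
    IsLUB (τ '' D) (τ x)

/-- `τ` is a normal, faithful, tracial state (positivity is part of the type of `τ`). -/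
structure IsNormalFaithfulTracialState (τ : M →ₚ[ℂ] ℂ) : Prop where
  map_one : τ 1 = 1
  normal : IsNormal τ
  faithful : ∀ x : M, τ (star x * x) = 0 → x = 0
  tracial : ∀ x y : M, τ (x * y) = τ (y * x)

/-- The singular number
`s_t(a) = inf {‖a (1 - q)‖ : q a projection of M, τ(q) ≤ t}` of `a` with respect to `τ`. -/
def singularNumber (τ : M →ₚ[ℂ] ℂ) (t : ℝ) (a : M) : ℝ :=
  sInf {r : ℝ | ∃ q : M, IsStarProjection q ∧ (τ q).re ≤ t ∧ r = ‖a * (1 - q)‖}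

/-- A unital ⋆-subalgebra `N` of `M` is a *W⋆-subalgebra* if it is closed in the weak-⋆ topology
that `M` carries as the dual of its predual. -/
def IsWStarSubalgebra (N : StarSubalgebra ℂ M) : Prop :=
  ∃ (X : Type u) (_ : NormedAddCommGroup X) (_ : NormedSpace ℂ X) (_ : CompleteSpace X)
    (e : StrongDual ℂ X ≃ₗᵢ⋆[ℂ] M),
    IsClosed {φ : WeakDual ℂ X | e (WeakDual.toStrongDual φ) ∈ N}

/-- `E` is the `τ`-preserving conditional expectation of `M` onto `N`: a positive linear
projection of `M` onto `N` that is an `N`-bimodule map and satisfies `τ ∘ E = τ`. -/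
structure IsTracePreservingCondExp (τ : M →ₚ[ℂ] ℂ) (N : StarSubalgebra ℂ M)
    (E : M →ₗ[ℂ] M) : Prop where
  mem : ∀ x : M, E x ∈ N
  apply_of_mem : ∀ y ∈ N, E y = y
  nonneg : ∀ x : M, 0 ≤ x → 0 ≤ E x
  bimodule : ∀ y ∈ N, ∀ z ∈ N, ∀ x : M, E (y * x * z) = y * E x * z
  trace_apply : ∀ x : M, τ (E x) = τ x

/-- The canonical map `x ↦ x̂` of `M` into `L²(M, τ)`, the Hilbert space of the GNS construction. -/
def hat (τ : M →ₚ[ℂ] ℂ) : M →ₗ[ℂ] τ.GNS :=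
  (UniformSpace.Completion.toComplL : τ.PreGNS →L[ℂ] τ.GNS).toLinearMap ∘ₗ
    τ.toPreGNS.toLinearMap

/-- `L²(N, τ|_N)` as a closed subspace of `L²(M, τ)`: the closure of the image of `N`. -/
def L2Sub (τ : M →ₚ[ℂ] ℂ) (N : StarSubalgebra ℂ M) : Submodule ℂ τ.GNS :=
  (N.toSubalgebra.toSubmodule.map (hat τ)).topologicalClosure

end Trace

section Hilbert

variable {H : Type*} [NormedAddCommGroup H] [InnerProductSpace ℂ H] [CompleteSpace H]

/-- The spectral subspace of a self-adjoint operator `A` for a closed set `C` of real numbers: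
all vectors annihilated by `f(A)` for every continuous `f` that vanishes on `C`, that is, all
vectors whose spectral measure is carried by `C`. -/
def spectralSubspace (A : H →L[ℂ] H) (C : Set ℝ) : Submodule ℂ H :=
  ⨅ (f : C(ℝ, ℝ)) (_ : ∀ t ∈ C, f t = 0), (cfc (f : ℝ → ℝ) A).ker

theorem isClosed_spectralSubspace (A : H →L[ℂ] H) (C : Set ℝ) :
    IsClosed (spectralSubspace A C : Set H) := by
  simp only [spectralSubspace, Submodule.coe_iInf]
  exact isClosed_iInter fun f => isClosed_iInter fun _ =>
    ContinuousLinearMap.isClosed_ker (cfc (f : ℝ → ℝ) A)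

instance hasOrthogonalProjection_spectralSubspace (A : H →L[ℂ] H) (C : Set ℝ) :
    (spectralSubspace A C).HasOrthogonalProjection :=
  haveI : CompleteSpace (spectralSubspace A C) :=
    (isClosed_spectralSubspace A C).completeSpace_coe
  inferInstance

/-- The spectral projection `1_C(A)` of a self-adjoint operator `A` for a closed set `C`. -/
def spectralProjection (A : H →L[ℂ] H) (C : Set ℝ) : H →L[ℂ] H :=
  (spectralSubspace A C).starProjection

/-- `V` is a nontrivial hyperinvariant subspace of `A`: a closed subspace other than `0` and the
whole space that is invariant under every bounded operator commuting with `A`. -/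
structure IsNontrivialHyperinvariant (A : H →L[ℂ] H) (V : Submodule ℂ H) : Prop where
  isClosed : IsClosed (V : Set H)
  ne_bot : V ≠ ⊥
  ne_top : V ≠ ⊤
  invariant : ∀ S : H →L[ℂ] H, S * A = A * S → ∀ v ∈ V, S v ∈ V

end Hilbert

end TracialVN

end

noncomputable section

namespace TracialVN

/-! ### Order intervals as intersections of norm balls, and suprema of increasing sequences. -/

section Order

variable {M : Type u} [CStarAlgebra M]

/-! Suppose `b` has no nontrivial hyperinvariant subspace. Then `b` is injective, so `b*` has dense
range, and the orbit of `ζ'` under the commutant of `b*` is dense; hence so are the vectors `b*^p S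
ζ'` with `S` commuting with `b*`.

Write `s_k` for the singular number of `b^{n(k)}`. `exists_contractions` gives `c_k` of norm at most
`√2 / s_k` such that `f_k = b^{n(k)} c_k` is a self-adjoint contraction with `‖f_k‖₂ ≥ θ/2`. Then
`f_k b*^p S ζ_k = c_k* S b*^{n(k)+p} ζ_k`, and the spectral condition on `ζ_k` bounds this by a
multiple of `√μ_k / s_k`, which tends to 0 (`tendsto_contraction_apply`). So the contractions `f_k`
tend to 0 on a dense set, hence at the vector of `1`, contradicting `‖f_k‖₂ ≥ θ/2`.

The bound `θ/2` comes from `le_two_mul_re_trace_cfc`: a smaller trace would give a spectral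
projection of trace below `θ` that violates the definition of `s_k`. That this projection lies in
`M` is derived from the predual through Banach–Alaoglu and normality of `τ`. -/

/-- Closed balls are weak-⋆ compact, so a weak-⋆ cluster point stays in every closed ball that
eventually contains the sequence. -/
theorem exists_limit_in_closedBalls [WStarAlgebra M] (x : ℕ → M) {C : ℝ} (hx : ∀ m, ‖x m‖ ≤ C) :
    ∃ z : M, ∀ (c : M) (r : ℝ), (∀ᶠ m in atTop, ‖x m - c‖ ≤ r) → ‖z - c‖ ≤ r := by
  obtain ⟨X, _, _, _, ⟨e⟩⟩ := WStarAlgebra.exists_predual (M := M)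
  let g : M → WeakDual ℂ X := fun m => StrongDual.toWeakDual (e.symm m)
  have hball (y c : M) (r : ℝ) : g y ∈ WeakDual.toStrongDual ⁻¹' Metric.closedBall (e.symm c) r ↔
      ‖y - c‖ ≤ r := by
    change e.symm y ∈ Metric.closedBall (e.symm c) r ↔ _
    rw [mem_closedBall_iff_norm, ← map_sub, LinearIsometryEquiv.norm_map]
  have hcomp := WeakDual.isCompact_closedBall (𝕜 := ℂ) (E := X) (e.symm 0) C
  obtain ⟨w, -, hw⟩ := hcomp.exists_mapClusterPt (f := atTop) (u := fun m => g (x m))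
    (by
      rw [le_principal_iff, mem_map]
      refine Eventually.of_forall fun m => ?_
      change g (x m) ∈ _
      rw [hball]; simpa using hx m)
  refine ⟨e (WeakDual.toStrongDual w), fun c r hcr => ?_⟩
  rw [← hball]
  have hgw : g (e (WeakDual.toStrongDual w)) = w := by simp [g]
  rw [hgw]
  refine (WeakDual.isClosed_closedBall (𝕜 := ℂ) (e.symm c) r).mem_of_mapClusterPt hw ?_
  filter_upwards [hcr] with m hm
  exact (hball _ _ _).mpr hm

variable [PartialOrder M] [StarOrderedRing M]

/-- A disc centred on the line `Re = R/2` with 0 on its boundary contains the segment `[0, R]`. With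
the converse below, order intervals become intersections of balls and so pass to weak-⋆ limits. -/
theorem norm_sub_algebraMap_le_of_mem_Icc {x : M} {R : ℝ}
    (h0 : 0 ≤ x) (h1 : x ≤ algebraMap ℝ M R) {c : ℂ} (hc : c.re = R / 2) :
    ‖x - algebraMap ℂ M c‖ ≤ ‖c‖ := by
  have hx : IsSelfAdjoint x := .of_nonneg h0
  have key : x - algebraMap ℂ M c = cfc (fun z : ℂ => z - c) x := by
    rw [cfc_sub (fun z : ℂ => z) (fun _ => c) x, cfc_id' ℂ x, cfc_const c x]
  rw [key]
  refine norm_cfc_le (norm_nonneg _) fun z hz => ?_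
  obtain ⟨t, ht, rfl⟩ : ∃ t ∈ spectrum ℝ x, (t : ℂ) = z := by
    have := hx.spectrumRestricts
    have h2 := this.algebraMap_image
    rw [← h2] at hz
    obtain ⟨t, ht, rfl⟩ := hz
    exact ⟨t, ht, rfl⟩
  have ht0 : 0 ≤ t := spectrum_nonneg_of_nonneg h0 ht
  have ht1 : t ≤ R := (le_algebraMap_iff_spectrum_le (a := x) (r := R)).mp h1 t ht
  rw [← sq_le_sq₀ (norm_nonneg _) (norm_nonneg _), Complex.sq_norm, Complex.sq_norm,
    Complex.normSq_apply, Complex.normSq_apply]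
  simp only [Complex.sub_re, Complex.sub_im, Complex.ofReal_re, Complex.ofReal_im, hc]
  nlinarith

/-- Moving the centre along the line `Re = R/2` gives a bound on `t • v` uniform in real `t`, where
`v` is the skew part of `x` up to a scalar. Hence `v = 0`, and the centre `R/2` then bounds the
self-adjoint `x - R/2`. -/
theorem mem_Icc_of_norm_sub_algebraMap_le {x : M} {R : ℝ} (hR : 0 ≤ R)
    (h : ∀ c : ℂ, c.re = R / 2 → ‖x - algebraMap ℂ M c‖ ≤ ‖c‖) :
    0 ≤ x ∧ x ≤ algebraMap ℝ M R := by
  set y : M := x - algebraMap ℝ M (R / 2) with hy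
  set v : M := Complex.I • (star y - y) with hv
  have hle (t : ℝ) : star y * y + t • v ≤ algebraMap ℝ M ((R / 2) ^ 2) := by
    have h1 := h ((R / 2 : ℝ) + (-t : ℝ) * Complex.I) (by simp)
    have h2 : x - algebraMap ℂ M ((R / 2 : ℝ) + (-t : ℝ) * Complex.I) =
        y + ((t : ℂ) * Complex.I) • (1 : M) := by
      rw [hy, IsScalarTower.algebraMap_apply ℝ ℂ M, Complex.coe_algebraMap]
      simp only [map_add, Algebra.algebraMap_eq_smul_one]
      push_cast
      module
    rw [h2] at h1
    have h3 : star (y + ((t : ℂ) * Complex.I) • (1 : M)) * (y + ((t : ℂ) * Complex.I) • (1 : M))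
        = star y * y + t • v + algebraMap ℝ M (t ^ 2) := by
      simp only [star_add, star_smul, star_one, add_mul, mul_add, smul_mul_assoc, one_mul,
        mul_smul_comm, mul_one, hv, Algebra.algebraMap_eq_smul_one, ← Complex.coe_smul, star_mul',
        Complex.star_def, Complex.conj_I, Complex.conj_ofReal, smul_smul, smul_sub, smul_add]
      have : (t : ℂ) * Complex.I * (t * -Complex.I) = ((t ^ 2 : ℝ) : ℂ) := by
        push_cast
        linear_combination (-(t : ℂ) ^ 2) * Complex.I_sq
      rw [this]
      module
    have h4 := CStarAlgebra.star_mul_le_algebraMap_norm_sq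
      (a := y + ((t : ℂ) * Complex.I) • (1 : M))
    rw [h3] at h4
    have h5 : ‖y + ((t : ℂ) * Complex.I) • (1 : M)‖ ^ 2 ≤ (R / 2) ^ 2 + t ^ 2 := by
      calc _ ≤ ‖(((R / 2 : ℝ) : ℂ) + ((-t : ℝ) : ℂ) * Complex.I)‖ ^ 2 := by gcongr
        _ = _ := by
          rw [Complex.sq_norm, Complex.normSq_add_mul_I]; ring
    have h6 : algebraMap ℝ M (‖y + ((t : ℂ) * Complex.I) • (1 : M)‖ ^ 2) ≤
        algebraMap ℝ M ((R / 2) ^ 2 + t ^ 2) := algebraMap_mono M h5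
    rw [map_add] at h6
    exact le_of_add_le_add_right (h4.trans h6)
  have hle' (t : ℝ) : t • v ≤ algebraMap ℝ M ((R / 2) ^ 2) :=
    (le_add_of_nonneg_left (star_mul_self_nonneg y)).trans (hle t)
  have hvsa : IsSelfAdjoint v := by
    rw [isSelfAdjoint_iff, hv, star_smul, star_sub, star_star, Complex.star_def, Complex.conj_I]
    module
  have hspec (t : ℝ) (s : ℝ) (hs : s ∈ spectrum ℝ v) : t * s ≤ (R / 2) ^ 2 := by
    have h1 : cfc (fun s : ℝ => t * s) v ≤ algebraMap ℝ M ((R / 2) ^ 2) := by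
      rw [cfc_const_mul t (fun s : ℝ => s) v, cfc_id' ℝ v]
      exact hle' t
    exact (cfc_le_algebraMap_iff (fun s : ℝ => t * s) _ v).mp h1 s hs
  have hv0 : v = 0 := by
    have h0 : ∀ s ∈ spectrum ℝ v, s = 0 := by
      intro s hs
      by_contra hne
      have := hspec (((R / 2) ^ 2 + 1) / s) s hs
      rw [div_mul_cancel₀ _ hne] at this
      linarith
    rw [← cfc_id' ℝ v, cfc_congr (g := fun _ => (0 : ℝ)) (fun s hs => h0 s hs)]
    exact cfc_const_zero ℝ v
  have hysa : IsSelfAdjoint y := by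
    rw [hv, smul_eq_zero] at hv0
    exact sub_eq_zero.mp (hv0.resolve_left Complex.I_ne_zero)
  have hyn : ‖y‖ ≤ R / 2 := by
    have := h ((R / 2 : ℝ)) (by simp)
    rw [Complex.norm_real, Real.norm_of_nonneg (by positivity)] at this
    rw [hy, IsScalarTower.algebraMap_apply ℝ ℂ M]
    exact this
  have hx : x = y + algebraMap ℝ M (R / 2) := by simp [hy]
  have hm := algebraMap_mono M hyn
  constructor
  · have := hysa.neg_algebraMap_norm_le_self
    rw [hx, ← neg_le_iff_add_nonneg]
    exact (neg_le_neg hm).trans this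
  · have := hysa.le_algebraMap_norm_self.trans hm
    rw [hx]
    calc _ ≤ algebraMap ℝ M (R / 2) + algebraMap ℝ M (R / 2) := by gcongr
      _ = _ := by rw [← map_add]; congr 1; ring

theorem exists_isLUB_range_of_monotone [WStarAlgebra M] (x : ℕ → M) (hmono : Monotone x)
    (h0 : ∀ m, 0 ≤ x m) (h1 : ∀ m, x m ≤ 1) : ∃ z : M, IsLUB (Set.range x) z := by
  obtain ⟨z, hz⟩ := exists_limit_in_closedBalls x
    (fun m => (CStarAlgebra.norm_le_one_iff_of_nonneg (x m) (h0 m)).mpr (h1 m))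
  refine ⟨z, ?_, ?_⟩
  · rintro _ ⟨m, rfl⟩
    refine sub_nonneg.mp (mem_Icc_of_norm_sub_algebraMap_le (x := z - x m) (zero_le_one' ℝ) ?_).1
    intro c hc
    rw [sub_sub]
    refine hz _ _ ?_
    filter_upwards [eventually_ge_atTop m] with k hk
    rw [← sub_sub]
    refine norm_sub_algebraMap_le_of_mem_Icc (sub_nonneg.mpr (hmono hk)) ?_ hc
    rw [map_one]
    exact (sub_le_self _ (h0 m)).trans (h1 k)
  · intro y hy
    have hy0 : 0 ≤ y := (h0 0).trans (hy ⟨0, rfl⟩)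
    refine sub_nonneg.mp (mem_Icc_of_norm_sub_algebraMap_le (x := y - z) (norm_nonneg y) ?_).1
    intro c hc
    have hrw (u : M) : ‖y - u - algebraMap ℂ M c‖ = ‖u - (y - algebraMap ℂ M c)‖ := by
      rw [← norm_neg]; congr 1; abel
    rw [hrw]
    refine hz _ _ (Eventually.of_forall fun k => ?_)
    rw [← hrw]
    refine norm_sub_algebraMap_le_of_mem_Icc (sub_nonneg.mpr (hy ⟨k, rfl⟩)) ?_ hc
    exact (sub_le_self _ (h0 k)).trans (IsSelfAdjoint.of_nonneg hy0).le_algebraMap_norm_self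

end Order

/-! ### The 2-norm of the trace, and projections as suprema. -/

section TraceNorm

variable {M : Type u} [CStarAlgebra M] [PartialOrder M]

theorem re_le_re_of_le (τ : M →ₚ[ℂ] ℂ) {x y : M} (h : x ≤ y) : (τ x).re ≤ (τ y).re :=
  (Complex.le_def.mp (OrderHomClass.mono τ h)).1

theorem im_eq_zero_of_nonneg {τ : M →ₚ[ℂ] ℂ} {x : M} (h : 0 ≤ x) : (τ x).im = 0 :=
  (Complex.nonneg_iff.mp (τ.map_nonneg h)).2.symm

variable [StarOrderedRing M] (τ : M →ₚ[ℂ] ℂ)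

theorem inner_hat (x y : M) : ⟪hat τ x, hat τ y⟫_ℂ = τ (star x * y) := by
  change ⟪((τ.toPreGNS x : τ.PreGNS) : τ.GNS), ((τ.toPreGNS y : τ.PreGNS) : τ.GNS)⟫_ℂ = _
  rw [UniformSpace.Completion.inner_coe, PositiveLinearMap.preGNS_inner_def]
  simp

theorem norm_hat_sq (x : M) : ‖hat τ x‖ ^ 2 = (τ (star x * x)).re := by
  rw [← inner_hat, ← inner_self_eq_norm_sq (𝕜 := ℂ)]; rfl

theorem gnsStarAlgHom_hat (x y : M) : τ.gnsStarAlgHom x (hat τ y) = hat τ (x * y) := by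
  change τ.gnsNonUnitalStarAlgHom x ((τ.toPreGNS y : τ.PreGNS) : τ.GNS) = _
  rw [PositiveLinearMap.gnsNonUnitalStarAlgHom_apply_coe]
  simp [hat]

theorem norm_gnsStarAlgHom_le (x : M) : ‖τ.gnsStarAlgHom x‖ ≤ ‖x‖ :=
  NonUnitalStarAlgHom.norm_apply_le τ.gnsStarAlgHom x

theorem norm_hat_mul_le (x y : M) : ‖hat τ (x * y)‖ ≤ ‖x‖ * ‖hat τ y‖ := by
  rw [← gnsStarAlgHom_hat]
  exact (τ.gnsStarAlgHom x).le_of_opNorm_le (norm_gnsStarAlgHom_le τ x) _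

variable {τ}

theorem IsNormalFaithfulTracialState.norm_hat_star (hτ : IsNormalFaithfulTracialState τ) (x : M) :
    ‖hat τ (star x)‖ = ‖hat τ x‖ := by
  rw [← sq_eq_sq₀ (norm_nonneg _) (norm_nonneg _), norm_hat_sq, norm_hat_sq, star_star,
    hτ.tracial]

theorem IsNormalFaithfulTracialState.norm_hat_mul_le' (hτ : IsNormalFaithfulTracialState τ)
    (x y : M) : ‖hat τ (x * y)‖ ≤ ‖hat τ x‖ * ‖y‖ := by
  rw [← hτ.norm_hat_star, star_mul, mul_comm, ← hτ.norm_hat_star x, ← norm_star y]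
  exact norm_hat_mul_le τ _ _

theorem IsNormalFaithfulTracialState.eq_zero_of_hat_eq_zero (hτ : IsNormalFaithfulTracialState τ)
    {x : M} (h : hat τ x = 0) : x = 0 := by
  apply hτ.faithful
  rw [← inner_hat, h, inner_zero_left]

theorem IsNormalFaithfulTracialState.norm_hat_one (hτ : IsNormalFaithfulTracialState τ) :
    ‖hat τ 1‖ = 1 := by
  rw [← sq_eq_sq₀ (norm_nonneg _) zero_le_one, norm_hat_sq]
  simp [hτ.map_one]

/-- For `0 ≤ d ≤ 1` one has `d² ≤ d`, so `‖d‖₂² ≤ τ(d)`; normality sends `τ(z - x m)` to 0. -/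
theorem IsNormalFaithfulTracialState.tendsto_hat_sub (hτ : IsNormalFaithfulTracialState τ)
    {x : ℕ → M} (hmono : Monotone x) (h0 : ∀ m, 0 ≤ x m) (h1 : ∀ m, x m ≤ 1) {z : M}
    (hz : IsLUB (Set.range x) z) : Tendsto (fun m => ‖hat τ (z - x m)‖) atTop (𝓝 0) := by
  have hz1 : z ≤ 1 := hz.2 (by rintro _ ⟨m, rfl⟩; exact h1 m)
  have hz0 : 0 ≤ z := (h0 0).trans (hz.1 ⟨0, rfl⟩)
  have hlub := hτ.normal (Set.range x) z (Set.range_nonempty x)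
    hmono.directed_le.directedOn_range (by rintro _ ⟨m, rfl⟩; exact h0 m) hz
  have hT : Tendsto (fun m => (τ (x m)).re) atTop (𝓝 (τ z).re) := by
    refine tendsto_atTop_isLUB (fun i j hij => re_le_re_of_le τ (hmono hij)) ⟨?_, ?_⟩
    · rintro _ ⟨m, rfl⟩
      exact re_le_re_of_le τ (hz.1 ⟨m, rfl⟩)
    · intro r hr
      have : τ z ≤ (r : ℂ) := by
        refine hlub.2 ?_
        rintro _ ⟨_, ⟨m, rfl⟩, rfl⟩
        exact Complex.le_def.mpr ⟨hr ⟨m, rfl⟩, by simp [im_eq_zero_of_nonneg (h0 m)]⟩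
      simpa using (Complex.le_def.mp this).1
  have hT' : Tendsto (fun m => (τ (z - x m)).re) atTop (𝓝 0) := by
    simpa [map_sub] using hT.const_sub (τ z).re
  have hsq : Tendsto (fun m => ‖hat τ (z - x m)‖ ^ 2) atTop (𝓝 0) := by
    refine squeeze_zero (fun _ => sq_nonneg _) (fun m => ?_) hT'
    have hd : 0 ≤ z - x m := sub_nonneg.mpr (hz.1 ⟨m, rfl⟩)
    have hd1 : z - x m ≤ 1 := (sub_le_self _ (h0 m)).trans hz1
    rw [norm_hat_sq, (IsSelfAdjoint.of_nonneg hd).star_eq]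
    refine re_le_re_of_le τ ?_
    have := CStarAlgebra.pow_antitone hd hd1 (show 1 ≤ 2 by norm_num)
    simpa [sq] using this
  simpa [Real.sqrt_sq] using hsq.sqrt

theorem IsNormalFaithfulTracialState.isStarProjection_of_isLUB
    (hτ : IsNormalFaithfulTracialState τ)
    {x : ℕ → M} (hmono : Monotone x) (h0 : ∀ m, 0 ≤ x m) (h1 : ∀ m, x m ≤ 1)
    (hmul : ∀ m k, m < k → x k * x m = x m) {z : M} (hz : IsLUB (Set.range x) z) :
    IsStarProjection z ∧ ∀ m, z * x m = x m := by
  have hlim := hτ.tendsto_hat_sub hmono h0 h1 hz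
  have hzx (m : ℕ) : z * x m = x m := by
    rw [← sub_eq_zero]
    apply hτ.eq_zero_of_hat_eq_zero
    rw [← norm_le_zero_iff]
    have hlim' := hlim.mul_const ‖x m‖
    rw [zero_mul] at hlim'
    refine ge_of_tendsto hlim' ?_
    filter_upwards [eventually_gt_atTop m] with k hk
    have : z * x m - x m = (z - x k) * x m := by rw [sub_mul, hmul m k hk]
    rw [this]
    exact hτ.norm_hat_mul_le' _ _
  refine ⟨⟨?_, .of_nonneg ((h0 0).trans (hz.1 ⟨0, rfl⟩))⟩, hzx⟩
  rw [IsIdempotentElem, ← sub_eq_zero]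
  apply hτ.eq_zero_of_hat_eq_zero
  rw [← norm_le_zero_iff]
  have hlim' := hlim.const_mul ‖z - 1‖
  rw [mul_zero] at hlim'
  refine ge_of_tendsto hlim' (Eventually.of_forall fun m => ?_)
  have : z * z - z = (z - 1) * (z - x m) := by
    rw [sub_mul, mul_sub, hzx, one_mul]; abel
  rw [this]
  exact norm_hat_mul_le τ _ _

end TraceNorm

/-! ### Spectral projections in `M` and singular numbers. -/

section SpectralCutoff

/-- A continuous approximation of the indicator function of `(r, ∞)` from below. -/
def cutoff (r : ℝ) (m : ℕ) (t : ℝ) : ℝ := max 0 (min 1 ((t - r) * 2 ^ (m + 1) - 1))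

theorem continuous_cutoff (r : ℝ) (m : ℕ) : Continuous (cutoff r m) := by
  unfold cutoff; fun_prop

theorem cutoff_nonneg (r : ℝ) (m : ℕ) (t : ℝ) : 0 ≤ cutoff r m t := le_max_left _ _

theorem cutoff_le_one (r : ℝ) (m : ℕ) (t : ℝ) : cutoff r m t ≤ 1 :=
  max_le zero_le_one (min_le_left _ _)

theorem cutoff_eq_zero {r t : ℝ} {m : ℕ} (h : (t - r) * 2 ^ (m + 1) ≤ 1) : cutoff r m t = 0 :=
  max_eq_left ((min_le_right _ _).trans (by linarith))

theorem cutoff_eq_one {r t : ℝ} {m : ℕ} (h : 1 ≤ (t - r) * 2 ^ m) : cutoff r m t = 1 := by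
  have : 1 ≤ (t - r) * 2 ^ (m + 1) - 1 := by rw [pow_succ]; linarith
  simp [cutoff, min_eq_left this]

/-- The `m`-th cutoff vanishes for `t - r ≤ 2^{-(m+1)}`, and beyond that point every later one is
already 1. -/
theorem cutoff_mul_cutoff {r : ℝ} {m k : ℕ} (hmk : m < k) (t : ℝ) :
    cutoff r k t * cutoff r m t = cutoff r m t := by
  rcases le_or_gt ((t - r) * 2 ^ (m + 1)) 1 with h | h
  · rw [cutoff_eq_zero h, mul_zero]
  · rw [cutoff_eq_one (m := k), one_mul]
    have ht : 0 < t - r := by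
      by_contra hle
      have : (t - r) * 2 ^ (m + 1) ≤ 0 :=
        mul_nonpos_of_nonpos_of_nonneg (not_lt.mp hle) (by positivity)
      linarith
    have : (2 : ℝ) ^ (m + 1) ≤ 2 ^ k := pow_le_pow_right₀ one_le_two hmk
    nlinarith

theorem cutoff_le_succ (r : ℝ) (m : ℕ) (t : ℝ) : cutoff r m t ≤ cutoff r (m + 1) t := by
  rw [← cutoff_mul_cutoff (Nat.lt_succ_self m)]
  exact mul_le_of_le_one_right (cutoff_nonneg _ _ _) (cutoff_le_one _ _ _)

theorem cutoff_le_two_mul_div {r t : ℝ} (hr : 0 < r) (ht : 0 ≤ t) (m : ℕ) :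
    cutoff r m t ≤ 2 * (t / (t + r)) := by
  rcases le_or_gt t r with h | h
  · rw [cutoff_eq_zero]
    · positivity
    · have : (t - r) * 2 ^ (m + 1) ≤ 0 :=
        mul_nonpos_of_nonpos_of_nonneg (by linarith) (by positivity)
      linarith
  · refine (cutoff_le_one _ _ _).trans ?_
    rw [mul_div_assoc', le_div_iff₀ (by linarith)]
    linarith

variable {M : Type u} [CStarAlgebra M] [PartialOrder M] [StarOrderedRing M] {τ : M →ₚ[ℂ] ℂ}

/-- The projection plays the role of `1_{(r,∞)}(x*x)`, as the supremum of continuous cutoffs. The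
factor 2 arises because `t/(t+r) ≥ 1/2` for `t ≥ r`. -/
theorem IsNormalFaithfulTracialState.exists_isStarProjection_norm_mul_one_sub_le [WStarAlgebra M]
    (hτ : IsNormalFaithfulTracialState τ) (x : M) {r r' : ℝ} (hr : 0 < r) (hr' : r < r') :
    ∃ q : M, IsStarProjection q ∧
      (τ q).re ≤ 2 * (τ (cfc (fun t : ℝ => t / (t + r)) (star x * x))).re ∧
      ‖x * (1 - q)‖ ^ 2 ≤ r' := by
  set a := star x * x with ha
  have ha0 : 0 ≤ a := star_mul_self_nonneg x
  have hsa : IsSelfAdjoint a := .of_nonneg ha0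
  have hspec : ∀ t ∈ spectrum ℝ a, 0 ≤ t := fun t ht => spectrum_nonneg_of_nonneg ha0 ht
  have hc (m : ℕ) : ContinuousOn (cutoff r m) (spectrum ℝ a) := (continuous_cutoff r m).continuousOn
  have hch : ContinuousOn (fun t : ℝ => t / (t + r)) (spectrum ℝ a) := by
    refine continuousOn_id.div (by fun_prop) fun t ht => ?_
    have := hspec t ht
    positivity
  let y : ℕ → M := fun m => cfc (cutoff r m) a
  have hmono : Monotone y := monotone_nat_of_le_succ fun m =>
    cfc_mono (fun t _ => cutoff_le_succ r m t) (hc m) (hc (m + 1))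
  have h0 (m : ℕ) : 0 ≤ y m := cfc_nonneg fun t _ => cutoff_nonneg r m t
  have h1 (m : ℕ) : y m ≤ 1 := cfc_le_one _ _ fun t _ => cutoff_le_one r m t
  obtain ⟨q, hq⟩ := exists_isLUB_range_of_monotone y hmono h0 h1
  obtain ⟨hproj, hqy⟩ := hτ.isStarProjection_of_isLUB hmono h0 h1 (fun m k hmk => by
    rw [← cfc_mul _ _ a (hc k) (hc m)]
    exact cfc_congr fun t _ => cutoff_mul_cutoff hmk t) hq
  refine ⟨q, hproj, ?_, ?_⟩
  · have hle : q ≤ cfc (fun t : ℝ => 2 * (t / (t + r))) a := by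
      refine hq.2 ?_
      rintro _ ⟨m, rfl⟩
      exact cfc_mono (fun t ht => cutoff_le_two_mul_div hr (hspec t ht) m) (hc m)
        (continuousOn_const.mul hch)
    rw [cfc_const_mul (2 : ℝ) _ a hch] at hle
    refine (re_le_re_of_le τ hle).trans_eq ?_
    rw [← Complex.coe_smul, map_smul]
    simp
  · obtain ⟨m, hm⟩ : ∃ m : ℕ, 1 < (r' - r) * 2 ^ m := by
      obtain ⟨m, hm⟩ := pow_unbounded_of_one_lt (1 / (r' - r)) (one_lt_two (α := ℝ))
      refine ⟨m, ?_⟩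
      rwa [div_lt_iff₀' (by linarith)] at hm
    -- The `m`-th cutoff is 1 wherever `g` is nonzero, thanks to the gap `r < r'`; so `1 - q` kills
    -- `g(a)`, and what remains of `a` has norm at most `r'`.
    let g : ℝ → ℝ := fun t => max (t - r') 0
    have hg : Continuous g := by fun_prop
    have hgm : y m * cfc g a = cfc g a := by
      rw [← cfc_mul _ _ a (hc m) hg.continuousOn]
      refine cfc_congr fun t _ => ?_
      rcases le_or_gt t r' with h | h
      · simp [g, h]
      · have : cutoff r m t = 1 := cutoff_eq_one (by
          have : (r' - r) * 2 ^ m ≤ (t - r) * 2 ^ m := by gcongr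
          linarith)
        simp [this]
    have hqg : (1 - q) * cfc g a = 0 := by
      rw [← hgm, ← mul_assoc, sub_mul, hqy m, one_mul, sub_self, zero_mul]
    have hag : ‖a - cfc g a‖ ≤ r' := by
      have : a - cfc g a = cfc (fun t : ℝ => t - g t) a := by
        rw [cfc_sub (fun t : ℝ => t) g a, cfc_id' ℝ a]
      rw [this]
      refine norm_cfc_le (by linarith) fun t ht => ?_
      have h3 := hspec t ht
      rw [Real.norm_eq_abs, abs_le]
      simp only [g]
      rcases le_total (t - r') 0 with h | h
      · rw [max_eq_right h]; constructor <;> linarith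
      · rw [max_eq_left h]; constructor <;> linarith
    have hq1 : ‖1 - q‖ ≤ 1 := hproj.one_sub.norm_le
    have hqs : star (1 - q) = 1 - q := hproj.one_sub.isSelfAdjoint
    have : star (x * (1 - q)) * (x * (1 - q)) = (1 - q) * (a - cfc g a) * (1 - q) := by
      rw [mul_sub (1 - q), hqg, sub_zero, star_mul, hqs, ha]
      simp only [mul_assoc]
    rw [sq, ← CStarRing.norm_star_mul_self, this]
    have hr0 : 0 ≤ r' := by linarith
    calc _ ≤ ‖1 - q‖ * ‖a - cfc g a‖ * ‖1 - q‖ := norm_mul₃_le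
      _ ≤ 1 * r' * 1 := by gcongr
      _ = r' := by ring

theorem IsNormalFaithfulTracialState.le_two_mul_re_trace_cfc [WStarAlgebra M]
    (hτ : IsNormalFaithfulTracialState τ) (x : M) {r θ : ℝ} (hr : 0 < r)
    (hrs : r < singularNumber τ θ x ^ 2) :
    θ ≤ 2 * (τ (cfc (fun t : ℝ => t / (t + r)) (star x * x))).re := by
  by_contra! hlt
  obtain ⟨r', h1, h2⟩ := exists_between hrs
  obtain ⟨q, hq, hqτ, hqn⟩ := hτ.exists_isStarProjection_norm_mul_one_sub_le x hr h1
  have hs : singularNumber τ θ x ≤ ‖x * (1 - q)‖ := by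
    refine csInf_le ⟨0, ?_⟩ ⟨q, hq, by linarith, rfl⟩
    rintro _ ⟨q, -, -, rfl⟩
    exact norm_nonneg _
  have hs0 : 0 ≤ singularNumber τ θ x := by
    refine Real.sInf_nonneg ?_
    rintro _ ⟨q, -, -, rfl⟩
    exact norm_nonneg _
  have : singularNumber τ θ x ^ 2 ≤ ‖x * (1 - q)‖ ^ 2 := by gcongr
  linarith

/-- A positive contraction of large trace through which `x` can be inverted on the right with
control of the norm. -/
theorem IsNormalFaithfulTracialState.exists_right_inverse [WStarAlgebra M]
    (hτ : IsNormalFaithfulTracialState τ) (x : M) {r θ : ℝ} (hr : 0 < r)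
    (hrs : r < singularNumber τ θ x ^ 2) :
    ∃ c : M, ‖c‖ ≤ (√r)⁻¹ ∧ ‖x * c‖ ≤ 1 ∧ IsSelfAdjoint (x * c) ∧ θ / 2 ≤ ‖hat τ (x * c)‖ := by
  set a := star x * x with ha
  have ha0 : 0 ≤ a := star_mul_self_nonneg x
  have hsa : IsSelfAdjoint a := .of_nonneg ha0
  have hspec : ∀ t ∈ spectrum ℝ a, 0 ≤ t := fun t ht => spectrum_nonneg_of_nonneg ha0 ht
  -- With `w = (a + r)^{-1/2}` and `y = xw`, the witness is `c = w y*`, so that `xc = y y*` is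
  -- positive and has the same trace as `y*y = a/(a + r)`.
  let g : ℝ → ℝ := fun t => (√(t + r))⁻¹
  have hg : ContinuousOn g (spectrum ℝ a) := by
    refine ContinuousOn.inv₀ (by fun_prop) fun t ht => ?_
    have := hspec t ht
    positivity
  set w : M := cfc g a with hw
  have hws : star w = w := (cfc_predicate g a : IsSelfAdjoint w)
  have hyy : star (x * w) * (x * w) = cfc (fun t : ℝ => t / (t + r)) a := by
    have h1 : star (x * w) * (x * w) = w * a * w := by
      rw [star_mul, hws, ha]; simp only [mul_assoc]
    have h2 : w * a * w = cfc (fun t : ℝ => g t * t * g t) a := by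
      rw [cfc_mul (fun t => g t * t) g a, cfc_mul g (fun t => t) a, cfc_id' ℝ a]
    rw [h1, h2]
    refine cfc_congr fun t ht => ?_
    have h3 : 0 < t + r := by linarith [hspec t ht]
    have h4 := Real.mul_self_sqrt h3.le
    simp only [g]
    rw [mul_comm _ t, mul_assoc, ← mul_inv, h4, div_eq_mul_inv]
  have hyn : ‖x * w‖ ≤ 1 := by
    rw [← sq_le_one_iff₀ (norm_nonneg _), sq, ← CStarRing.norm_star_mul_self, hyy]
    refine norm_cfc_le zero_le_one fun t ht => ?_
    have h3 := hspec t ht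
    rw [Real.norm_of_nonneg (by positivity), div_le_one (by positivity)]
    linarith
  have hwn : ‖w‖ ≤ (√r)⁻¹ := by
    refine norm_cfc_le (by positivity) fun t ht => ?_
    have h3 := hspec t ht
    rw [Real.norm_of_nonneg (by positivity)]
    have : √r ≤ √(t + r) := Real.sqrt_le_sqrt (by linarith)
    have : 0 < √r := by positivity
    simp only [g]
    gcongr
  have hf : x * (w * star (x * w)) = x * w * star (x * w) := by rw [mul_assoc]
  refine ⟨w * star (x * w), ?_, ?_, ?_, ?_⟩
  · calc _ ≤ ‖w‖ * ‖star (x * w)‖ := norm_mul_le _ _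
      _ ≤ (√r)⁻¹ * 1 := by rw [norm_star]; gcongr
      _ = _ := mul_one _
  · rw [hf, CStarRing.norm_self_mul_star]
    exact mul_le_one₀ hyn (norm_nonneg _) hyn
  · rw [hf]; exact .mul_star_self _
  · rw [hf]
    have h1 := hτ.le_two_mul_re_trace_cfc x hr hrs
    rw [← ha, ← hyy, hτ.tracial] at h1
    have h2 : (τ (x * w * star (x * w))).re ≤ ‖hat τ (x * w * star (x * w))‖ := by
      have h3 : τ (x * w * star (x * w)) = ⟪hat τ 1, hat τ (x * w * star (x * w))⟫_ℂ := by
        rw [inner_hat, star_one, one_mul]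
      rw [h3]
      refine (Complex.re_le_norm _).trans ((norm_inner_le_norm _ _).trans_eq ?_)
      rw [hτ.norm_hat_one, one_mul]
    linarith

end SpectralCutoff

/-! ### Kernels, cyclic subspaces and spectral subspaces on a Hilbert space. -/

section Hyperinvariant

variable {H : Type*} [NormedAddCommGroup H] [InnerProductSpace ℂ H]

theorem isNontrivialHyperinvariant_ker {A : H →L[ℂ] H} (hA : A ≠ 0) (hker : A.ker ≠ ⊥) :
    IsNontrivialHyperinvariant A A.ker where
  isClosed := A.isClosed_ker
  ne_bot := hker
  ne_top h := hA <| by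
    ext v
    have : v ∈ A.ker := h ▸ Submodule.mem_top
    simpa using this
  invariant S hS v hv := by
    have h1 : A v = 0 := hv
    change A (S v) = 0
    rw [← mul_apply_eq_comp, ← hS, mul_apply_eq_comp, h1, map_zero]

theorem tendsto_zero_of_dense {F : ℕ → H →L[ℂ] H} {C : ℝ} (hF : ∀ k, ‖F k‖ ≤ C) {s : Set H}
    (hs : Dense s) (h : ∀ v ∈ s, Tendsto (fun k => F k v) atTop (𝓝 0)) (v : H) :
    Tendsto (fun k => F k v) atTop (𝓝 0) := by
  have hC : 0 ≤ C := (norm_nonneg _).trans (hF 0)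
  rw [Metric.tendsto_atTop]
  intro ε hε
  obtain ⟨w, hw, hvw⟩ := Metric.dense_iff.mp hs v (ε / (2 * (C + 1))) (by positivity)
  obtain ⟨K, hK⟩ := Metric.tendsto_atTop.mp (h _ hvw) (ε / 2) (by positivity)
  refine ⟨K, fun k hk => ?_⟩
  have h1 := hK k hk
  rw [dist_zero_right] at h1 ⊢
  rw [mem_ball_iff_norm'] at hw
  calc ‖F k v‖ = ‖F k (v - w) + F k w‖ := by rw [← map_add, sub_add_cancel]
    _ ≤ ‖F k (v - w)‖ + ‖F k w‖ := norm_add_le _ _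
    _ ≤ C * (ε / (2 * (C + 1))) + ‖F k w‖ := by
      gcongr
      exact ((F k).le_of_opNorm_le (hF k) _).trans (by gcongr)
    _ < (C + 1) * (ε / (2 * (C + 1))) + ε / 2 := by
      have : 0 < ε / (2 * (C + 1)) := by positivity
      nlinarith
    _ = ε := by field_simp; ring

variable [CompleteSpace H]

/-- The function `(t - μ)₊` vanishes on `[0, μ]`, so on `ζ` the operator `A` acts as its truncation
`min(A, μ)`. -/
theorem re_inner_le_of_mem_spectralSubspace {A : H →L[ℂ] H} (hA : 0 ≤ A) {μ : ℝ} (hμ : 0 ≤ μ)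
    {ζ : H} (hζ : ζ ∈ spectralSubspace A (Set.Icc 0 μ)) :
    (⟪A ζ, ζ⟫_ℂ).re ≤ μ * ‖ζ‖ ^ 2 := by
  let f : C(ℝ, ℝ) := ⟨fun t => max (t - μ) 0, by fun_prop⟩
  have hsa : IsSelfAdjoint A := .of_nonneg hA
  have hfζ : cfc (f : ℝ → ℝ) A ζ = 0 := by
    simp only [spectralSubspace, Submodule.mem_iInf] at hζ
    exact hζ f fun t ht => max_eq_right (by linarith [ht.2])
  have hAζ : A ζ = cfc (fun t => t - f t) A ζ := by
    rw [cfc_sub (fun t : ℝ => t) f A, cfc_id' ℝ A, sub_apply, hfζ, sub_zero]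
  have hn : ‖cfc (fun t => t - f t) A‖ ≤ μ := by
    refine norm_cfc_le hμ fun t ht => ?_
    have h0 : 0 ≤ t := spectrum_nonneg_of_nonneg hA ht
    change ‖t - max (t - μ) 0‖ ≤ μ
    rw [Real.norm_eq_abs, abs_le]
    rcases le_total (t - μ) 0 with h | h
    · rw [max_eq_right h]; constructor <;> linarith
    · rw [max_eq_left h]; constructor <;> linarith
  calc _ ≤ ‖A ζ‖ * ‖ζ‖ := (Complex.re_le_norm _).trans (norm_inner_le_norm _ _)
    _ ≤ μ * ‖ζ‖ * ‖ζ‖ := by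
      rw [hAζ]
      gcongr
      exact ContinuousLinearMap.le_of_opNorm_le _ hn ζ
    _ = _ := by ring

theorem mem_spectralSubspace_of_eq_spectralProjection {A : H →L[ℂ] H} {C : Set ℝ} {ζ : H}
    (h : ζ = spectralProjection A C ζ) : ζ ∈ spectralSubspace A C := by
  rw [h]
  exact Submodule.starProjection_apply_mem _ _

/-- The cyclic subspace generated by `ζ` under the commutant of the adjoint of `A`. -/
def cyclicSubspace (A : H →L[ℂ] H) (ζ : H) : Submodule ℂ H :=
  (Subalgebra.centralizer ℂ {star A}).toSubmodule.map
    (ContinuousLinearMap.apply ℂ H ζ : (H →L[ℂ] H) →ₗ[ℂ] H)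

theorem mem_cyclicSubspace {A : H →L[ℂ] H} {ζ v : H} :
    v ∈ cyclicSubspace A ζ ↔ ∃ S : H →L[ℂ] H, star A * S = S * star A ∧ S ζ = v := by
  simp [cyclicSubspace, Subalgebra.mem_centralizer_iff]

/-- Adjoints exchange the commutants of `A` and `A*`, so the complement of a subspace invariant
under the commutant of `A*` is hyperinvariant for `A`. -/
theorem isNontrivialHyperinvariant_orthogonal_cyclicSubspace {A : H →L[ℂ] H} {ζ : H} (hζ : ζ ≠ 0)
    (h : (cyclicSubspace A ζ)ᗮ ≠ ⊥) :
    IsNontrivialHyperinvariant A (cyclicSubspace A ζ)ᗮ where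
  isClosed := Submodule.isClosed_orthogonal _
  ne_bot := h
  ne_top htop := hζ <| by
    have h1 : ζ ∈ (cyclicSubspace A ζ)ᗮ := htop ▸ Submodule.mem_top
    have h2 : ζ ∈ cyclicSubspace A ζ := mem_cyclicSubspace.mpr ⟨1, by simp, rfl⟩
    exact inner_self_eq_zero.mp ((Submodule.mem_orthogonal _ _).mp h1 ζ h2)
  invariant S hS v hv := by
    rw [Submodule.mem_orthogonal] at hv ⊢
    intro u hu
    obtain ⟨T, hT, rfl⟩ := mem_cyclicSubspace.mp hu
    rw [← ContinuousLinearMap.adjoint_inner_left]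
    refine hv _ (mem_cyclicSubspace.mpr ⟨star S * T, ?_, rfl⟩)
    have hS' : star A * star S = star S * star A := by
      rw [← star_mul, ← star_mul, hS]
    rw [← mul_assoc, hS', mul_assoc, hT, mul_assoc]

theorem dense_image_star_pow {A : H →L[ℂ] H} (hker : A.ker = ⊥) (p : ℕ) {s : Set H}
    (hs : Dense s) : Dense ((star A ^ p : H →L[ℂ] H) '' s) := by
  have h1 : DenseRange (star A : H →L[ℂ] H) := by
    have h2 : (star A : H →L[ℂ] H).rangeᗮ = ⊥ := by
      rw [ContinuousLinearMap.orthogonal_range, ContinuousLinearMap.star_eq_adjoint,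
        ContinuousLinearMap.adjoint_adjoint, hker]
    rw [← Submodule.topologicalClosure_eq_top_iff] at h2
    exact Submodule.dense_iff_topologicalClosure_eq_top.mpr h2
  induction p with
  | zero => simpa using hs
  | succ p ih =>
    have hcomp : ⇑(star A ^ (p + 1) : H →L[ℂ] H) = ⇑(star A) ∘ ⇑(star A ^ p : H →L[ℂ] H) := by
      rw [pow_succ']; rfl
    rw [hcomp, Set.image_comp]
    exact h1.dense_image (star A : H →L[ℂ] H).continuous ih

end Hyperinvariant

/-! ### Conditional expectation and decay of the contractions. -/

section CondExp

variable {M : Type u} [CStarAlgebra M] [PartialOrder M] [StarOrderedRing M] {τ : M →ₚ[ℂ] ℂ}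
  {N : StarSubalgebra ℂ M} {E : M →ₗ[ℂ] M}

/-- For `ζ` the vector of `y ∈ N`, the bimodule property and `τ ∘ E = τ` turn both sides into `τ(y*
x x* y)`; density extends this. -/
theorem IsTracePreservingCondExp.norm_sq_gnsStarAlgHom_star
    (hE : IsTracePreservingCondExp τ N E) (x : M) {ζ : τ.GNS} (hζ : ζ ∈ L2Sub τ N) :
    ‖τ.gnsStarAlgHom (star x) ζ‖ ^ 2 = (⟪τ.gnsStarAlgHom (E (x * star x)) ζ, ζ⟫_ℂ).re := by
  have hclosed : IsClosed {ζ : τ.GNS |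
      ‖τ.gnsStarAlgHom (star x) ζ‖ ^ 2 = (⟪τ.gnsStarAlgHom (E (x * star x)) ζ, ζ⟫_ℂ).re} :=
    isClosed_eq (by fun_prop) (by fun_prop)
  refine closure_minimal ?_ hclosed hζ
  rintro _ ⟨y, hy, rfl⟩
  have hy : y ∈ N := hy
  have hpos : 0 ≤ E (x * star x) := hE.nonneg _ (mul_star_self_nonneg x)
  simp only [Set.mem_ofPred_eq]
  rw [gnsStarAlgHom_hat, gnsStarAlgHom_hat, norm_hat_sq, inner_hat, star_mul, star_mul,
    (IsSelfAdjoint.of_nonneg hpos).star_eq, ← hE.bimodule _ (star_mem hy) _ hy, hE.trace_apply,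
    star_star]
  simp only [mul_assoc]

theorem IsTracePreservingCondExp.norm_gnsStarAlgHom_star_le
    (hE : IsTracePreservingCondExp τ N E) (x : M) {μ : ℝ} (hμ : 0 ≤ μ) {ζ : τ.GNS}
    (hζN : ζ ∈ L2Sub τ N)
    (hζ : ζ = spectralProjection (τ.gnsStarAlgHom (E (x * star x))) (Set.Icc 0 μ) ζ) :
    ‖τ.gnsStarAlgHom (star x) ζ‖ ≤ √μ * ‖ζ‖ := by
  rw [← sq_le_sq₀ (norm_nonneg _) (by positivity), mul_pow, Real.sq_sqrt hμ,
    hE.norm_sq_gnsStarAlgHom_star x hζN]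
  refine re_inner_le_of_mem_spectralSubspace ?_ hμ
    (mem_spectralSubspace_of_eq_spectralProjection hζ)
  exact map_nonneg τ.gnsStarAlgHom (hE.nonneg _ (mul_star_self_nonneg x))

theorem tendsto_contraction_apply (b : M) (p : ℕ) (n : ℕ → ℕ) (hE : IsTracePreservingCondExp τ N E)
    (μ s : ℕ → ℝ) (hμ : ∀ k, 0 ≤ μ k) (hratio : Tendsto (fun k => μ k / s k ^ 2) atTop (𝓝 0))
    (c : ℕ → M) (hcn : ∀ k, ‖c k‖ ≤ √(2 / s k ^ 2)) (hf1 : ∀ k, ‖b ^ n k * c k‖ ≤ 1)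
    (hfs : ∀ k, b ^ n k * c k = star (c k) * star b ^ n k)
    (ζ : ℕ → τ.GNS) (hζN : ∀ k, ζ k ∈ L2Sub τ N)
    (hζ : ∀ k, ζ k = spectralProjection
        (τ.gnsStarAlgHom (E (b ^ (n k + p) * star b ^ (n k + p)))) (Set.Icc 0 (μ k)) (ζ k))
    {ζ' : τ.GNS} (hlim : Tendsto ζ atTop (𝓝 ζ')) (S : τ.GNS →L[ℂ] τ.GNS)
    (hS : star (τ.gnsStarAlgHom b) * S = S * star (τ.gnsStarAlgHom b)) :
    Tendsto (fun k => τ.gnsStarAlgHom (b ^ n k * c k) ((star (τ.gnsStarAlgHom b) ^ p) (S ζ')))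
      atTop (𝓝 0) := by
  set π := τ.gnsStarAlgHom with hπ
  set P : τ.GNS →L[ℂ] τ.GNS := star (π b) ^ p * S with hP
  have hsmall (k : ℕ) : ‖π (b ^ n k * c k) (P (ζ k))‖ ≤
      √2 * √(μ k / s k ^ 2) * (‖S‖ * ‖ζ k‖) := by
    have hcomm : ∀ m : ℕ, star (π b) ^ m * S = S * star (π b) ^ m := fun m =>
      (Commute.pow_left (show Commute (star (π b)) S from hS) m).eq
    -- Self-adjointness of `b^{n(k)} c_k` brings the powers of `b*` together, and `S` commutes past
    -- them, so they act directly on `ζ k`.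
    have h1 : π (b ^ n k * c k) * P = π (star (c k)) * (S * π (star (b ^ (n k + p)))) := by
      rw [hfs, hP, map_mul, map_pow, star_pow, map_pow, map_star π b, mul_assoc,
        ← mul_assoc (star (π b) ^ n k), ← pow_add, hcomm]
    have h2 := hζ k
    rw [← star_pow] at h2
    have h3 := hE.norm_gnsStarAlgHom_star_le _ (hμ k) (hζN k) h2
    have h4 : ‖π (star (c k))‖ ≤ √(2 / s k ^ 2) :=
      (norm_gnsStarAlgHom_le τ _).trans (by rw [norm_star]; exact hcn k)
    calc ‖π (b ^ n k * c k) (P (ζ k))‖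
        = ‖π (star (c k)) (S (π (star (b ^ (n k + p))) (ζ k)))‖ := congrArg (fun T => ‖T (ζ k)‖) h1
      _ ≤ √(2 / s k ^ 2) * (‖S‖ * (√(μ k) * ‖ζ k‖)) := by
        refine ((π (star (c k))).le_of_opNorm_le h4 _).trans ?_
        gcongr
        exact (S.le_opNorm _).trans (by gcongr)
      _ = √(2 / s k ^ 2) * √(μ k) * (‖S‖ * ‖ζ k‖) := by ring
      _ = _ := by
        congr 1
        rw [← Real.sqrt_mul (by positivity), ← Real.sqrt_mul zero_le_two]
        congr 1; ring
  have hdiff (k : ℕ) : ‖π (b ^ n k * c k) (P (ζ' - ζ k))‖ ≤ ‖P‖ * ‖ζ' - ζ k‖ := by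
    refine (ContinuousLinearMap.le_of_opNorm_le _
      ((norm_gnsStarAlgHom_le τ _).trans (hf1 k)) _).trans ?_
    rw [one_mul]
    exact P.le_opNorm _
  have hlim1 : Tendsto (fun k => ‖P‖ * ‖ζ' - ζ k‖) atTop (𝓝 0) := by
    simpa using (hlim.const_sub ζ').norm.const_mul ‖P‖
  have hlim2 : Tendsto (fun k => √2 * √(μ k / s k ^ 2) * (‖S‖ * ‖ζ k‖)) atTop (𝓝 0) := by
    simpa using (hratio.sqrt.const_mul √2).mul (hlim.norm.const_mul ‖S‖)
  have hsum := hlim1.add hlim2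
  rw [add_zero] at hsum
  refine squeeze_zero_norm (fun k => ?_) hsum
  calc ‖π (b ^ n k * c k) (P ζ')‖
      = ‖π (b ^ n k * c k) (P (ζ' - ζ k)) + π (b ^ n k * c k) (P (ζ k))‖ := by
        rw [← map_add, ← map_add, sub_add_cancel]
    _ ≤ _ := (norm_add_le _ _).trans (add_le_add (hdiff k) (hsmall k))

end CondExp

theorem singularNumber_zero {M : Type u} [CStarAlgebra M] [PartialOrder M] (τ : M →ₚ[ℂ] ℂ)
    {t : ℝ} (ht : 0 ≤ t) : singularNumber τ t 0 = 0 := by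
  refine le_antisymm (csInf_le ⟨0, ?_⟩ ⟨0, .zero M, by simpa using ht, by simp⟩)
    (Real.sInf_nonneg ?_)
  all_goals
    rintro _ ⟨q, -, -, rfl⟩
    exact norm_nonneg _

/-! ### The contractions attached to the powers of `b`. -/

section Contractions

variable {M : Type u} [CStarAlgebra M] [PartialOrder M] [StarOrderedRing M] [WStarAlgebra M]
  {τ : M →ₚ[ℂ] ℂ}

/-- The contractions that cut `b ^ n k` down to the part where it is bounded below. -/
theorem IsNormalFaithfulTracialState.exists_contractions
    (hτ : IsNormalFaithfulTracialState τ) (b : M) (n : ℕ → ℕ) (θ : ℝ)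
    (hs : ∀ k, singularNumber τ θ (b ^ n k) ≠ 0) :
    ∃ c : ℕ → M, ∀ k, ‖c k‖ ≤ √(2 / singularNumber τ θ (b ^ n k) ^ 2) ∧
      ‖b ^ n k * c k‖ ≤ 1 ∧ b ^ n k * c k = star (c k) * star b ^ n k ∧
      θ / 2 ≤ ‖hat τ (b ^ n k * c k)‖ := by
  -- Any fixed fraction of the squared singular number would serve; strict inequality is needed, and
  -- one half produces the constant 2.
  choose c hc using fun k => hτ.exists_right_inverse (b ^ n k)
    (r := singularNumber τ θ (b ^ n k) ^ 2 / 2) (θ := θ)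
    (by have := hs k; positivity)
    (by have : 0 < singularNumber τ θ (b ^ n k) ^ 2 := by have := hs k; positivity
        linarith)
  refine ⟨c, fun k => ?_⟩
  obtain ⟨h1, h2, h3, h4⟩ := hc k
  refine ⟨?_, h2, ?_, h4⟩
  · rwa [← Real.sqrt_inv, inv_div] at h1
  · rw [← star_pow, ← star_mul, h3.star_eq]

end Contractions
end TracialVN

end
theorem mainTheorem4 {M : Type u} [CStarAlgebra M] [PartialOrder M] [StarOrderedRing M]
    [WStarAlgebra M]
    (τ : M →ₚ[ℂ] ℂ) (hτ : TracialVN.IsNormalFaithfulTracialState τ)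
    (N : StarSubalgebra ℂ M) (hN : TracialVN.IsWStarSubalgebra N)
    (E : M →ₗ[ℂ] M) (hE : TracialVN.IsTracePreservingCondExp τ N E)
    (b : M) (p : ℕ) (n : ℕ → ℕ) (hn : StrictMono n) (hn1 : ∀ k, 1 ≤ n k)
    (θ : ℝ) (hθ : θ ∈ Set.Ioo (0 : ℝ) 1)
    (μ : ℕ → ℝ) (hμ : ∀ k, 0 ≤ μ k)
    (hs : ∀ k, TracialVN.singularNumber τ θ (b ^ n k) ≠ 0)
    (hratio : Tendsto (fun k => μ k / TracialVN.singularNumber τ θ (b ^ n k) ^ 2) atTop (𝓝 0))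
    (ζ : ℕ → τ.GNS) (hζN : ∀ k, ζ k ∈ TracialVN.L2Sub τ N)
    (hζ : ∀ k, ζ k =
      TracialVN.spectralProjection
        (τ.gnsStarAlgHom (E (b ^ (n k + p) * star b ^ (n k + p)))) (Set.Icc 0 (μ k)) (ζ k))
    (ζ' : τ.GNS) (hζ' : ζ' ≠ 0) (hlim : Tendsto ζ atTop (𝓝 ζ')) :
    ∃ V : Submodule ℂ τ.GNS, TracialVN.IsNontrivialHyperinvariant (τ.gnsStarAlgHom b) V := by
  by_contra hno
  push Not at hno
  have hb : τ.gnsStarAlgHom b ≠ 0 := by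
    intro h0
    have hb0 : b = 0 := hτ.eq_zero_of_hat_eq_zero (by
      rw [← mul_one b, ← TracialVN.gnsStarAlgHom_hat, h0, zero_apply])
    apply hs 0
    rw [hb0, zero_pow (Nat.one_le_iff_ne_zero.mp (hn1 0))]
    exact TracialVN.singularNumber_zero τ hθ.1.le
  have hker : (τ.gnsStarAlgHom b).ker = ⊥ := by
    by_contra h
    exact hno _ (TracialVN.isNontrivialHyperinvariant_ker hb h)
  have horth : (TracialVN.cyclicSubspace (τ.gnsStarAlgHom b) ζ')ᗮ = ⊥ := by
    by_contra h
    exact hno _ (TracialVN.isNontrivialHyperinvariant_orthogonal_cyclicSubspace hζ' h)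
  have hdense : Dense (TracialVN.cyclicSubspace (τ.gnsStarAlgHom b) ζ' : Set τ.GNS) :=
    Submodule.dense_iff_topologicalClosure_eq_top.mpr
      (Submodule.topologicalClosure_eq_top_iff.mpr horth)
  obtain ⟨c, hc⟩ := hτ.exists_contractions b n θ hs
  have hzero := TracialVN.tendsto_zero_of_dense (F := fun k => τ.gnsStarAlgHom (b ^ n k * c k))
    (fun k => (TracialVN.norm_gnsStarAlgHom_le τ _).trans (hc k).2.1)
    (TracialVN.dense_image_star_pow hker p hdense) (by
      rintro _ ⟨w, hw, rfl⟩
      obtain ⟨S, hS, rfl⟩ := TracialVN.mem_cyclicSubspace.mp hw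
      exact TracialVN.tendsto_contraction_apply b p n hE μ _ hμ hratio c (fun k => (hc k).1)
        (fun k => (hc k).2.1) (fun k => (hc k).2.2.1) ζ hζN hζ hlim S hS)
    (TracialVN.hat τ 1)
  -- At the vector of `1`, the norm of the image is the 2-norm of the contraction, which stays at
  -- least `θ/2`.
  have hnorm := hzero.norm
  simp only [TracialVN.gnsStarAlgHom_hat, mul_one, norm_zero] at hnorm
  have := ge_of_tendsto hnorm (Eventually.of_forall fun k => (hc k).2.2.2)
  linarith [hθ.1]
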